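/- For integers $y,n$ let $(y)_n$ denote the Pochhammer symbol: $(y)_n=y(y+1)\cdots(y+n-1)$ if $n>0$, $(y)_0=1$, and $(y)_n=\dfrac{1}{(y-1)(y-2)\cdots(y+n)}$ if $n<0$. For a non-negative integer $k$, a sequence $(a_i)_{i=1}^{l}$ and integers $t,x,h$ put \begin{align*} \Phi_{k}((a_i)_{i=1}^{l}; t,x,h)&=\prod_{i=1}^{l}\frac{(x+h+l+1-a_i)_{t+(k+1)a_i-l-k}}{(h+l+1-a_i)_{t+(k+1)a_i-l-k}}\\ &\times \prod_{j=1}^{k-1}\prod_{i=1}^{\lfloor \frac{l+k-j}{k+1}\rfloor}\frac{((k+1)(x+h)+t+k(k+1)i+(j-1)k-(k+1)(k-1))_{j}}{((k+1)h+t+k(k+1)i+(j-1)k-(k+1)(k-1))_{j}}\\ &\times \prod_{i=1}^{\lfloor \frac{l}{k+1}\rfloor}\frac{((k+1)(x+h)+t+k(k+1)i-k+1)_{(k+1)l+k-(k+1)^2i}}{((k+1)h+t+k(k+1)i-k+1)_{(k+1)l+k-(k+1)^2i}}, \end{align*} where empty products are $1$. A plane partition of shape $\lambda=(\lambda_1\ge\dots\ge\lambda_l\ge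 0)$ is a filling of the Young diagram of $\lambda$ with positive integers (its parts) that weakly decreases along rows (left to right) and down columns. Let $k,x,t,h,l$ be non-negative integers, let $1\le a_1<a_2<\dots<a_l\le h+l$ be integers, and put $a_{l+1}=l+h+1$. Then the number of plane partitions of shape $$(t+(k+1)a_l-k-l,\; t+(k+1)a_{l-1}-k-(l-1),\;\dots,\; t+(k+1)a_1-k-1)$$ whose parts in the $i$-th row are at least $a_{l-i+1}-l+i$ and at most $x+h+1$ (for $i=1,\dots,l$) is equal to $$\Phi_{k}((a_j)_{j=1}^{l}; t,x,h)\prod_{i=1}^{l}\Phi_{k}((a_j)_{j=1}^{i}; t,\,a_{i+1}-a_{i}-1,\,a_{i}-i).$$ -/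

import Mathlib

namespace HalvedHexagon

/-- The Pochhammer symbol `(y)_n` for an arbitrary integer `n`:
`y (y+1) ⋯ (y+n-1)` for `n ≥ 0` and `1 / ((y-1)(y-2) ⋯ (y+n))` for `n < 0`. -/
def poch (y : ℤ) : ℤ → ℚ
  | Int.ofNat n => ∏ i ∈ Finset.range n, ((y : ℚ) + i)
  | Int.negSucc m => (∏ i ∈ Finset.range (m + 1), ((y : ℚ) - (i + 1)))⁻¹

/-- The function `Φ_k((a_i)_{i=1}^l; t, x, h)`; only the values `a 1, …, a l` are used. -/
def Phi (k l : ℕ) (a : ℕ → ℕ) (t x h : ℤ) : ℚ :=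
  (∏ i ∈ Finset.Icc 1 l,
      poch (x + h + l + 1 - a i) (t + (k + 1) * a i - l - k) /
        poch (h + l + 1 - a i) (t + (k + 1) * a i - l - k)) *
    (∏ j ∈ Finset.Icc 1 (k - 1), ∏ i ∈ Finset.Icc 1 ((l + k - j) / (k + 1)),
      poch ((k + 1) * (x + h) + t + k * (k + 1) * i + (j - 1) * k - (k + 1) * (k - 1)) j /
        poch ((k + 1) * h + t + k * (k + 1) * i + (j - 1) * k - (k + 1) * (k - 1)) j) *
    ∏ i ∈ Finset.Icc 1 (l / (k + 1)),
      poch ((k + 1) * (x + h) + t + k * (k + 1) * i - k + 1)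
          ((k + 1) * l + k - (k + 1) ^ 2 * i) /
        poch ((k + 1) * h + t + k * (k + 1) * i - k + 1)
          ((k + 1) * l + k - (k + 1) ^ 2 * i)

/-- A plane partition of shape `μ`: a filling of the cells of `μ` with positive integers that is
weakly decreasing along rows and down columns. As for Mathlib's semistandard tableaux, the entries
are stored as a function on `ℕ × ℕ` that vanishes off `μ`; rows and columns are numbered from `0`. -/
@[ext]
structure PlanePartition (μ : YoungDiagram) where
  entry : ℕ → ℕ → ℕ
  row_weak : ∀ {i j₁ j₂ : ℕ}, j₁ < j₂ → (i, j₂) ∈ μ → entry i j₂ ≤ entry i j₁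
  col_weak : ∀ {i₁ i₂ j : ℕ}, i₁ < i₂ → (i₂, j) ∈ μ → entry i₂ j ≤ entry i₁ j
  pos : ∀ {i j : ℕ}, (i, j) ∈ μ → 0 < entry i j
  zeros : ∀ {i j : ℕ}, (i, j) ∉ μ → entry i j = 0

/-- The number `t + (k+1) a_j - k - j`. For `1 ≤ a_1 < ⋯ < a_l` and `1 ≤ j ≤ l` the subtraction
does not truncate. -/
def rowLength (k t : ℕ) (a : ℕ → ℕ) (j : ℕ) : ℕ := t + (k + 1) * a j - k - j

theorem le_of_strictMonoOn {l : ℕ} {a : ℕ → ℕ} (ha : StrictMonoOn a (Set.Icc 1 l))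
    (hpos : ∀ i ∈ Set.Icc 1 l, 1 ≤ a i) (j : ℕ) (hj : j ∈ Set.Icc 1 l) : j ≤ a j := by
  obtain ⟨h1, h2⟩ := hj
  induction j, h1 using Nat.le_induction with
  | base => exact hpos 1 ⟨le_rfl, h2⟩
  | succ n hn ih =>
    have h := ha (show n ∈ Set.Icc 1 l from ⟨hn, by omega⟩)
      (show n + 1 ∈ Set.Icc 1 l from ⟨by omega, h2⟩) (Nat.lt_succ_self n)
    have := ih (by omega)
    omega

theorem rowLength_cast {k t l : ℕ} {a : ℕ → ℕ} (ha : StrictMonoOn a (Set.Icc 1 l))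
    (hpos : ∀ i ∈ Set.Icc 1 l, 1 ≤ a i) (j : ℕ) (hj : j ∈ Set.Icc 1 l) :
    (rowLength k t a j : ℤ) = t + (k + 1) * a j - k - j := by
  have h1 := le_of_strictMonoOn ha hpos j hj
  have h2 := hpos j hj
  have h3 : k ≤ k * a j := Nat.le_mul_of_pos_right k h2
  have h4 : (k + 1) * a j = k * a j + a j := by ring
  have h5 : ((k : ℤ) + 1) * a j = ((k * a j : ℕ) : ℤ) + a j := by push_cast; ring
  unfold rowLength
  rw [h4, h5]
  omega

theorem rowLength_mono {k t l : ℕ} {a : ℕ → ℕ} (ha : StrictMonoOn a (Set.Icc 1 l))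
    (hpos : ∀ i ∈ Set.Icc 1 l, 1 ≤ a i) :
    MonotoneOn (rowLength k t a) (Set.Icc 1 l) := by
  have key : ∀ j, 1 ≤ j → j + 1 ≤ l → rowLength k t a j ≤ rowLength k t a (j + 1) := by
    intro j h1 h2
    have e1 := rowLength_cast (k := k) (t := t) ha hpos j ⟨h1, by omega⟩
    have e2 := rowLength_cast (k := k) (t := t) ha hpos (j + 1) ⟨by omega, h2⟩
    have h3 : a j < a (j + 1) := ha ⟨h1, by omega⟩ ⟨by omega, h2⟩ (Nat.lt_succ_self j)
    have h4 : (a j : ℤ) + 1 ≤ a (j + 1) := by exact_mod_cast h3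
    have h5 : (0 : ℤ) ≤ k := Int.natCast_nonneg k
    zify
    rw [e1, e2]
    push_cast
    nlinarith
  intro i hi j hj hij
  obtain ⟨hi1, -⟩ := hi
  obtain ⟨-, hj2⟩ := hj
  induction j, hij using Nat.le_induction with
  | base => exact le_rfl
  | succ n hn ih => exact (ih (by omega)).trans (key n (by omega) hj2)

/-- The shape `(t + (k+1) a_l - k - l, …, t + (k+1) a_1 - k - 1)`. -/
def shape (k t l : ℕ) (a : ℕ → ℕ) (ha : StrictMonoOn a (Set.Icc 1 l))
    (hpos : ∀ i ∈ Set.Icc 1 l, 1 ≤ a i) : YoungDiagram :=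
  YoungDiagram.ofRowLens (List.ofFn fun i : Fin l => rowLength k t a (l - i)) <| by
    rw [List.sortedGE_ofFn_iff]
    intro i j hij
    have hij' : (i : ℕ) ≤ j := hij
    exact rowLength_mono ha hpos ⟨by omega, by omega⟩ ⟨by omega, by omega⟩ (by omega)

end HalvedHexagon

/-! ### Fillings and the removal of their smallest entries. -/

namespace HalvedHexagon

open Finset

/-! Reversing the order of the rows and adding to each row its new index turns the plane partitions
into fillings that strictly increase in the row index, with lower bound `a (i + 1)` in row `i`
(counted from `0`) and one common strict upper bound `n` (`card_planePartition`). Removing the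
smallest admissible value from a filling gives a recursion that a determinant also satisfies, so the
fillings are counted by a determinant (`card_fillings`).

For these row lengths, entry `(i, j)` is a factor depending only on the row times a polynomial,
depending only on `j`, evaluated at `a (i + 1)`. The determinant is therefore a Vandermonde
determinant times an explicit product (`det_eval_mixedProd`). As a function of `c`, with `n = c + l
+ 1`, it is a constant times `psi` (`countDet_eq_mul_psi`), so replacing `c` by `x + c` multiplies
it by a value of `Phi`.

When `n` is just above the largest lower bound, the last row is frozen and can be deleted
(`countDet_succ`). Alternately lowering the bound and deleting the last row reduces the determinant
to the empty one; the ratios collected on the way are the factors of the theorem. -/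

/-- Fillings of rows of lengths `r i` that weakly decrease along the rows and strictly increase in
the row index, where row `i` has entries in `[max (a i) v, n)`; entries off the rows are `0`. -/
structure IsFilling {l : ℕ} (n : ℕ) (a : Fin l → ℕ) (v : ℕ) (r : Fin l → ℕ)
    (P : Fin l → ℕ → ℕ) : Prop where
  zeros : ∀ i m, r i ≤ m → P i m = 0
  lower : ∀ i m, m < r i → a i ≤ P i m
  level : ∀ i m, m < r i → v ≤ P i m
  upper : ∀ i m, m < r i → P i m < n
  row : ∀ i m m', m ≤ m' → m' < r i → P i m' ≤ P i m
  col : ∀ i j m, i < j → m < r i → P i m < P j m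

theorem finite_isFilling {l : ℕ} (n : ℕ) (a : Fin l → ℕ) (v : ℕ) (r : Fin l → ℕ) :
    {P | IsFilling n a v r P}.Finite := by
  have : Function.Injective (fun (P : {P | IsFilling n a v r P}) (i : Fin l) (m : Fin (r i)) =>
      (⟨P.1 i m, IsFilling.upper P.2 i m m.2⟩ : Fin n)) := by
    rintro ⟨P, hP⟩ ⟨Q, hQ⟩ h
    ext i m
    by_cases hm : m < r i
    · have := congrFun (congrFun h i) ⟨m, hm⟩
      simpa using this
    · change P i m = Q i m
      rw [hP.zeros i m (by omega), hQ.zeros i m (by omega)]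
  exact Finite.of_injective _ this

/-- The finset of fillings. -/
noncomputable def fillings {l : ℕ} (n : ℕ) (a : Fin l → ℕ) (v : ℕ) (r : Fin l → ℕ) :
    Finset (Fin l → ℕ → ℕ) := (finite_isFilling n a v r).toFinset

theorem mem_fillings {l : ℕ} {n : ℕ} {a : Fin l → ℕ} {v : ℕ} {r : Fin l → ℕ}
    {P : Fin l → ℕ → ℕ} : P ∈ fillings n a v r ↔ IsFilling n a v r P := by
  simp [fillings]

/-- The possible row lengths that remain when the entries equal to `v` are removed. -/
def peeled {l : ℕ} (a : Fin (l + 1) → ℕ) (v : ℕ) (r : Fin (l + 1) → ℕ) :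
    Finset (Fin (l + 1) → ℕ) :=
  Fintype.piFinset fun i =>
    if a i ≤ v then Icc ((Fin.cons 0 fun j : Fin l => r j.castSucc : Fin (l + 1) → ℕ) i) (r i)
    else {r i}

section peeled

variable {l : ℕ} {a : Fin (l + 1) → ℕ} {v : ℕ} {r M : Fin (l + 1) → ℕ}

theorem le_of_mem_peeled (hM : M ∈ peeled a v r) (i : Fin (l + 1)) : M i ≤ r i := by
  have := Fintype.mem_piFinset.1 hM i
  split_ifs at this
  · exact (mem_Icc.1 this).2
  · exact (mem_singleton.1 this).le

theorem eq_of_mem_peeled (hM : M ∈ peeled a v r) {i : Fin (l + 1)} (h : v < a i) :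
    M i = r i := by
  have := Fintype.mem_piFinset.1 hM i
  rw [if_neg (by omega)] at this
  exact mem_singleton.1 this

theorem le_of_lt_of_mem_peeled (hr : Monotone r) (hM : M ∈ peeled a v r) {i j : Fin (l + 1)}
    (h : i < j) : r i ≤ M j := by
  have := Fintype.mem_piFinset.1 hM j
  split_ifs at this
  · have := (mem_Icc.1 this).1
    obtain ⟨j, rfl⟩ := Fin.exists_succ_eq.2 (Fin.ne_zero_of_lt h)
    rw [Fin.cons_succ] at this
    exact (hr (Fin.le_castSucc_iff.2 h)).trans this
  · rw [mem_singleton.1 this]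
    exact hr h.le

theorem monotone_of_mem_peeled (hr : Monotone r) (hM : M ∈ peeled a v r) : Monotone M := by
  intro i j hij
  rcases hij.eq_or_lt with rfl | h
  · exact le_rfl
  · exact (le_of_mem_peeled hM i).trans (le_of_lt_of_mem_peeled hr hM h)

end peeled

theorem exists_lt_iff_of_antitone (p : ℕ → Prop) (N : ℕ) (hN : ¬ p N)
    (hp : ∀ m m', m ≤ m' → p m' → p m) : ∃ M, ∀ m, m < M ↔ p m := by
  classical
  refine ⟨Nat.find ⟨N, hN⟩, fun m => ⟨fun h => not_not.1 (Nat.find_min _ h), fun h => ?_⟩⟩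
  by_contra! hm
  exact Nat.find_spec (p := fun m => ¬ p m) ⟨N, hN⟩ (hp _ _ hm h)

/-- The entries equal to `v` sit at the ends of the rows. A cell of row `i` with a cell of row `i -
1` in the same column exceeds an entry that is at least `v`, so it survives the removal: the new
lengths interlace with the old ones. Rows with `v < a i` lose nothing. -/
theorem card_fillings_eq_sum {l : ℕ} {n : ℕ} {a : Fin (l + 1) → ℕ} {v : ℕ}
    {r : Fin (l + 1) → ℕ} (hr : Monotone r) (hv : v < n) :
    (fillings n a v r).card = ∑ M ∈ peeled a v r, (fillings n a (v + 1) M).card := by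
  rw [← card_sigma]
  symm
  refine card_bij (fun x _ i m => if m < x.1 i then x.2 i m else if m < r i then v else 0)
    ?_ ?_ ?_
  · rintro ⟨M, Q⟩ hx
    obtain ⟨hM, hQ⟩ : M ∈ peeled a v r ∧ Q ∈ fillings n a (v + 1) M := mem_sigma.1 hx
    replace hQ := mem_fillings.1 hQ
    have hle := le_of_mem_peeled hM
    refine mem_fillings.2 ⟨?_, ?_, ?_, ?_, ?_, ?_⟩
    · intro i m hm
      have := hle i
      simp only
      rw [if_neg (by omega), if_neg (by omega)]
    · intro i m hm
      simp only
      split_ifs with h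
      · exact hQ.lower i m h
      · by_contra! hav
        have := eq_of_mem_peeled hM hav
        omega
    · intro i m hm
      simp only
      split_ifs with h
      · exact (Nat.le_succ v).trans (hQ.level i m h)
      · exact le_rfl
    · intro i m hm
      simp only
      split_ifs with h
      · exact hQ.upper i m h
      · exact hv
    · intro i m m' hmm hm
      simp only
      by_cases h' : m' < M i
      · rw [if_pos h', if_pos (by omega)]
        exact hQ.row i m m' hmm h'
      · rw [if_neg h', if_pos hm]
        split_ifs with h
        · exact (Nat.le_succ v).trans (hQ.level i m h)
        · exact le_rfl
        · omega
    · intro i j m hij hm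
      have h1 : m < M j := hm.trans_le (le_of_lt_of_mem_peeled hr hM hij)
      simp only
      rw [if_pos h1]
      split_ifs with h
      · exact hQ.col i j m hij h
      · exact hQ.level j m h1
  · rintro ⟨M, Q⟩ hx ⟨M', Q'⟩ hx' heq
    obtain ⟨hM, hQ⟩ : M ∈ peeled a v r ∧ Q ∈ fillings n a (v + 1) M := mem_sigma.1 hx
    obtain ⟨hM', hQ'⟩ : M' ∈ peeled a v r ∧ Q' ∈ fillings n a (v + 1) M' := mem_sigma.1 hx'
    replace hQ := mem_fillings.1 hQ
    replace hQ' := mem_fillings.1 hQ'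
    have hle := le_of_mem_peeled hM
    have hle' := le_of_mem_peeled hM'
    have hE : ∀ i m, (if m < M i then Q i m else if m < r i then v else 0) =
        if m < M' i then Q' i m else if m < r i then v else 0 :=
      fun i m => congrFun (congrFun heq i) m
    have hMM : M = M' := by
      funext i
      have h1 := hE i (M i)
      have h2 := hE i (M' i)
      have l1 := hQ'.level i (M i)
      have l2 := hQ.level i (M' i)
      have := hle i
      have := hle' i
      rcases lt_trichotomy (M i) (M' i) with h | h | h
      · rw [if_neg (lt_irrefl _), if_pos h, if_pos (by omega)] at h1
        have := l1 h
        omega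
      · exact h
      · rw [if_neg (lt_irrefl _), if_pos h, if_pos (by omega)] at h2
        have := l2 h
        omega
    subst hMM
    have hQQ : Q = Q' := by
      funext i m
      by_cases h : m < M i
      · simpa [h] using hE i m
      · rw [hQ.zeros i m (not_lt.1 h), hQ'.zeros i m (not_lt.1 h)]
    rw [hQQ]
  · intro P hP
    replace hP := mem_fillings.1 hP
    have hex : ∀ i, ∃ M, ∀ m, m < M ↔ (m < r i ∧ v < P i m) := fun i =>
      exists_lt_iff_of_antitone _ (r i) (by simp) fun m m' hm h =>
        ⟨by omega, h.2.trans_le (hP.row i m m' hm h.1)⟩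
    choose M hM using hex
    have hle : ∀ i, M i ≤ r i := fun i => by
      by_contra! h
      have := ((hM i (r i)).1 h).1
      omega
    refine ⟨⟨M, fun i m => if m < M i then P i m else 0⟩, mem_sigma.2 ⟨?_, ?_⟩, ?_⟩
    · change M ∈ peeled a v r
      refine Fintype.mem_piFinset.2 fun i => ?_
      split_ifs with hav
      · refine mem_Icc.2 ⟨?_, hle i⟩
        induction i using Fin.cases with
        | zero => simp
        | succ j =>
          rw [Fin.cons_succ]
          by_contra! h
          have h1 := hP.level _ _ h
          have h2 := hP.col _ _ _ (Fin.castSucc_lt_succ (i := j)) h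
          have h3 := hr (Fin.castSucc_lt_succ (i := j)).le
          have := (hM j.succ (M j.succ)).2 ⟨by omega, by omega⟩
          omega
      · refine mem_singleton.2 (le_antisymm (hle i) ?_)
        by_contra! h
        have := hP.lower i _ h
        have := (hM i (M i)).2 ⟨h, by omega⟩
        omega
    · refine mem_fillings.2 ⟨?_, ?_, ?_, ?_, ?_, ?_⟩
      · intro i m hm
        exact if_neg (not_lt.2 hm)
      · intro i m hm
        have := (hM i m).1 hm
        simpa [hm] using hP.lower i m this.1
      · intro i m hm
        have := (hM i m).1 hm
        simpa [hm] using this.2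
      · intro i m hm
        have := (hM i m).1 hm
        simpa [hm] using hP.upper i m this.1
      · intro i m m' hmm hm
        simp only at hm
        have := (hM i m').1 hm
        simpa [hm, hmm.trans_lt hm] using hP.row i m m' hmm this.1
      · intro i j m hij hm
        simp only at hm
        have h1 := (hM i m).1 hm
        have h2 := hP.col i j m hij h1.1
        have h3 : m < M j := (hM j m).2 ⟨h1.1.trans_le (hr hij.le), by omega⟩
        simpa [hm, h3] using h2
    · funext i m
      simp only
      by_cases h : m < M i
      · rw [if_pos h, if_pos h]
      · rw [if_neg h]
        split_ifs with h1
        · have h2 := hP.level i m h1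
          have h3 := mt (hM i m).2 h
          have : ¬ v < P i m := fun h4 => h3 ⟨h1, h4⟩
          omega
        · exact (hP.zeros i m (not_lt.1 h1)).symm

/-! ### The determinant that counts fillings. -/

/-- The number of multisets of size `L - j` on `d` letters, which is `0` for `L < j`. -/
def pathCount (d L j : ℕ) : ℚ := if j ≤ L then (Nat.multichoose d (L - j) : ℚ) else 0

theorem pathCount_succ (d L j : ℕ) :
    pathCount (d + 1) (L + 1) j = pathCount (d + 1) L j + pathCount d (L + 1) j := by
  unfold pathCount
  rcases lt_trichotomy j (L + 1) with h | h | h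
  · rw [if_pos (by omega), if_pos (by omega), if_pos (by omega),
      show L + 1 - j = L - j + 1 by omega, Nat.multichoose_succ_succ]
    push_cast
    ring
  · subst h
    simp
  · rw [if_neg (by omega), if_neg (by omega), if_neg (by omega)]
    simp

theorem pathCount_succ_column (d L j : ℕ) :
    pathCount (d + 1) L j = pathCount d L j + pathCount (d + 1) L (j + 1) := by
  unfold pathCount
  rcases lt_trichotomy j L with h | h | h
  · rw [if_pos (by omega), if_pos (by omega), if_pos (by omega),
      show L - j = L - (j + 1) + 1 by omega, Nat.multichoose_succ_succ]
    push_cast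
    ring
  · subst h
    simp
  · rw [if_neg (by omega), if_neg (by omega), if_neg (by omega)]
    simp

theorem sum_range_pathCount (d L j : ℕ) :
    ∑ s ∈ range (L + 1), pathCount d s j = pathCount (d + 1) L j := by
  induction L with
  | zero => cases j <;> simp [pathCount]
  | succ L ih => rw [sum_range_succ, ih, ← pathCount_succ]

theorem sum_Icc_pathCount (d j i : ℕ) {s e : ℕ} (h : s ≤ e) :
    ∑ M ∈ Icc s e, pathCount d (M + (i + 1)) j =
      pathCount (d + 1) (e + (i + 1)) j - pathCount (d + 1) (s + i) j := by
  induction e, h using Nat.le_induction with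
  | base => rw [Icc_self, sum_singleton, ← add_assoc, pathCount_succ]; ring
  | succ e h ih =>
    rw [sum_Icc_succ_top (by omega), ih, show e + 1 + (i + 1) = e + (i + 1) + 1 by ring,
      pathCount_succ]
    ring

/-- The set `peeled` is a box, so by multilinearity the sum can be taken inside each row. There it
telescopes to the row of the right-hand matrix minus, when `a i ≤ v`, its predecessor; such row
operations preserve the determinant. -/
theorem sum_peeled_det {l : ℕ} {n : ℕ} {a : Fin (l + 1) → ℕ} {v : ℕ}
    {r : Fin (l + 1) → ℕ} (hr : Monotone r) (ha : Monotone a) (hv : v < n) :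
    ∑ M ∈ peeled a v r, (Matrix.of fun i j : Fin (l + 1) =>
        pathCount (n - max (a i) (v + 1)) (M i + i) j).det =
      (Matrix.of fun i j : Fin (l + 1) => pathCount (n - max (a i) v) (r i + i) j).det := by
  have h := MultilinearMap.map_sum_finset
    (Matrix.detRowAlternating (n := Fin (l + 1)) (R := ℚ)).toMultilinearMap
    (fun (i : Fin (l + 1)) (m : ℕ) (j : Fin (l + 1)) =>
      pathCount (n - max (a i) (v + 1)) (m + i) j)
    (fun i => if a i ≤ v then
      Icc ((Fin.cons 0 fun j : Fin l => r j.castSucc : Fin (l + 1) → ℕ) i) (r i) else {r i})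
  refine h.symm.trans ?_
  symm
  refine Matrix.det_eq_of_forall_row_eq_smul_add_pred
    (fun i => if a i.succ ≤ v then 1 else 0) (fun j => ?_) (fun i j => ?_)
  · by_cases hav : a 0 ≤ v
    · have : n - max (a 0) v = n - max (a 0) (v + 1) + 1 := by omega
      simp only [Matrix.of_apply, if_pos hav, this, Finset.sum_apply, Fin.cons_zero]
      rw [← sum_range_pathCount, range_eq_Ico]
      rfl
    · have : max (a 0) v = max (a 0) (v + 1) := by omega
      simp [if_neg hav, this]
  · by_cases hav : a i.succ ≤ v
    · have h1 := ha (Fin.castSucc_lt_succ (i := i)).le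
      have h2 : n - max (a i.succ) v = n - max (a i.succ) (v + 1) + 1 := by omega
      have h3 : n - max (a i.castSucc) v = n - max (a i.succ) (v + 1) + 1 := by omega
      simp only [Matrix.of_apply, if_pos hav, Finset.sum_apply, Fin.cons_succ, h2, h3,
        Fin.val_succ, Fin.val_castSucc]
      rw [sum_Icc_pathCount _ _ _ (hr (Fin.castSucc_lt_succ (i := i)).le)]
      ring
    · have : max (a i.succ) v = max (a i.succ) (v + 1) := by omega
      simp [if_neg hav, this]

/-- No value is left for any cell, so only the empty shape has a filling. With zero letters the
matrix is then the identity; otherwise its last row vanishes, because `r (Fin.last l) + l` exceeds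
every column index. -/
theorem card_fillings_top {l : ℕ} {n : ℕ} {a : Fin (l + 1) → ℕ}
    {r : Fin (l + 1) → ℕ} (hr : Monotone r) (han : ∀ i, a i ≤ n) :
    ((fillings n a n r).card : ℚ) =
      (Matrix.of fun i j : Fin (l + 1) => pathCount (n - max (a i) n) (r i + i) j).det := by
  have h0 : ∀ i, n - max (a i) n = 0 := fun i => by have := han i; omega
  simp only [h0]
  have hz : ∀ m : ℕ, m ≠ 0 → Nat.multichoose 0 m = 0 := fun m hm => by
    obtain ⟨m, rfl⟩ := Nat.exists_eq_succ_of_ne_zero hm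
    exact Nat.multichoose_zero_succ m
  by_cases h : r (Fin.last l) = 0
  · have hr0 : ∀ i, r i = 0 := fun i => Nat.le_zero.1 (h ▸ hr (Fin.le_last i))
    have hone : (Matrix.of fun i j : Fin (l + 1) => pathCount 0 (r i + i) j) = 1 := by
      ext i j
      rw [Matrix.of_apply, hr0, zero_add, pathCount, Matrix.one_apply]
      rcases lt_trichotomy i j with hij | rfl | hij
      · rw [if_neg (by simpa using hij), if_neg hij.ne]
      · simp
      · have : (j : ℕ) < i := hij
        rw [if_pos this.le, if_neg hij.ne', hz _ (by omega), Nat.cast_zero]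
    have hset : fillings n a n r = {fun _ _ => 0} := by
      ext P
      rw [mem_fillings, mem_singleton]
      constructor
      · intro hP
        funext i m
        exact hP.zeros i m (by simp [hr0])
      · rintro rfl
        constructor <;> simp [hr0]
    rw [hone, hset]
    simp
  · have hset : fillings n a n r = ∅ := by
      refine eq_empty_of_forall_notMem fun P hP => ?_
      have hP := mem_fillings.1 hP
      have h1 := hP.level (Fin.last l) 0 (by omega)
      have h2 := hP.upper (Fin.last l) 0 (by omega)
      omega
    rw [hset, Matrix.det_eq_zero_of_row_eq_zero (Fin.last l)]
    · simp
    · intro j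
      have := j.2
      rw [Matrix.of_apply, pathCount, Fin.val_last, if_pos (by omega), hz _ (by omega),
        Nat.cast_zero]

theorem card_fillings {l : ℕ} {n : ℕ} {a : Fin (l + 1) → ℕ} {v : ℕ} {r : Fin (l + 1) → ℕ}
    (ha : Monotone a) (han : ∀ i, a i ≤ n) (hv : v ≤ n) (hr : Monotone r) :
    ((fillings n a v r).card : ℚ) =
      (Matrix.of fun i j : Fin (l + 1) => pathCount (n - max (a i) v) (r i + i) j).det := by
  induction hv using Nat.decreasingInduction generalizing r with
  | self => exact card_fillings_top hr han
  | of_succ v hv ih =>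
    rw [card_fillings_eq_sum hr hv, Nat.cast_sum, ← sum_peeled_det hr ha hv]
    exact sum_congr rfl fun M hM => ih (monotone_of_mem_peeled hr hM)

end HalvedHexagon

/-! ### Plane partitions as fillings. -/

namespace HalvedHexagon

open Finset

theorem mem_shape {k t l : ℕ} {a : ℕ → ℕ} {ha : StrictMonoOn a (Set.Icc 1 l)}
    {hpos : ∀ i ∈ Set.Icc 1 l, 1 ≤ a i} {i m : ℕ} :
    (i, m) ∈ shape k t l a ha hpos ↔ i < l ∧ m < rowLength k t a (l - i) := by
  rw [shape, YoungDiagram.mem_ofRowLens]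
  simp

theorem IsFilling.add_sub_le {l : ℕ} {n : ℕ} {a : Fin l → ℕ} {v : ℕ} {r : Fin l → ℕ}
    {P : Fin l → ℕ → ℕ} (hP : IsFilling n a v r P) (hr : Monotone r) {i j : ℕ} (hij : i ≤ j)
    (hj : j < l) (m : ℕ) (hm : m < r ⟨i, by omega⟩) :
    P ⟨i, by omega⟩ m + (j - i) ≤ P ⟨j, hj⟩ m := by
  induction j, hij using Nat.le_induction with
  | base => simp
  | succ j hij ih =>
    have h1 := ih (by omega)
    have h2 := hP.col ⟨j, by omega⟩ ⟨j + 1, hj⟩ m (Fin.mk_lt_mk.2 (by omega))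
      (hm.trans_le (hr (Fin.mk_le_mk.2 hij)))
    omega

/-- Strictness forces one unit of growth for each later row, so the single bound `n` on the last row
yields the row-dependent bounds obtained by shifting the entries of a plane partition. -/
theorem IsFilling.add_le {l : ℕ} {n : ℕ} {a : Fin l → ℕ} {v : ℕ} {r : Fin l → ℕ}
    {P : Fin l → ℕ → ℕ} (hP : IsFilling n a v r P) (hr : Monotone r) (i : Fin l) (m : ℕ)
    (hm : m < r i) : P i m + (l - i) ≤ n := by
  have hi := i.2
  have h1 := hP.add_sub_le hr (show (i : ℕ) ≤ l - 1 by omega) (by omega) m hm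
  have h2 := hP.upper ⟨l - 1, by omega⟩ m (hm.trans_le (hr (Fin.le_def.2 (Nat.le_sub_one_of_lt i.2))))
  simp only [Fin.eta] at h1
  omega

theorem card_planePartition (k t l c : ℕ) (a : ℕ → ℕ) (ha : StrictMonoOn a (Set.Icc 1 l))
    (hpos : ∀ i ∈ Set.Icc 1 l, 1 ≤ a i) :
    Nat.card {π : PlanePartition (shape k t l a ha hpos) //
        ∀ i j : ℕ, (i, j) ∈ shape k t l a ha hpos →
          (a (l - i) : ℤ) - l + (i + 1) ≤ π.entry i j ∧ (π.entry i j : ℤ) ≤ c + 1} =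
      (fillings (c + l + 1) (fun i : Fin l => a (i + 1)) 0
        (fun i : Fin l => rowLength k t a (i + 1))).card := by
  have hr : Monotone (fun i : Fin l => rowLength k t a (i + 1)) := fun i j hij =>
    rowLength_mono ha hpos ⟨by omega, i.2⟩ ⟨by omega, j.2⟩ (by simpa using hij)
  have hbound : ∀ j ∈ Set.Icc 1 l, j ≤ a j := le_of_strictMonoOn ha hpos
  rw [← Nat.subtype_card _ (fun _ => mem_fillings)]
  refine Nat.card_congr
    { toFun := fun π => ⟨fun i m =>
        if m < rowLength k t a (i + 1) then π.1.entry (l - 1 - i) m + i else 0, ?_⟩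
      invFun := fun P => ⟨
        { entry := fun i m => if h : i < l ∧ m < rowLength k t a (l - i) then
            P.1 ⟨l - 1 - i, by omega⟩ m - (l - 1 - i) else 0
          row_weak := ?_
          col_weak := ?_
          pos := ?_
          zeros := ?_ }, ?_⟩
      left_inv := ?_
      right_inv := ?_ }
  · obtain ⟨π, hπ⟩ := π
    have hmem : ∀ (i : Fin l) (m : ℕ), m < rowLength k t a (i + 1) →
        (l - 1 - (i : ℕ), m) ∈ shape k t l a ha hpos := fun i m hm => by
      have := i.2
      rw [mem_shape, show l - (l - 1 - (i : ℕ)) = i + 1 by omega]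
      exact ⟨by omega, hm⟩
    have hlow : ∀ (i : Fin l) (m : ℕ), m < rowLength k t a (i + 1) →
        a (i + 1) ≤ π.entry (l - 1 - i) m + i ∧ π.entry (l - 1 - i) m ≤ c + 1 :=
      fun i m hm => by
        have := i.2
        have h := hπ _ _ (hmem i m hm)
        rw [show l - (l - 1 - (i : ℕ)) = i + 1 by omega] at h
        omega
    refine ⟨?_, ?_, ?_, ?_, ?_, ?_⟩
    · intro i m hm
      exact if_neg (not_lt.2 hm)
    · intro i m hm
      simp only [if_pos hm]
      exact (hlow i m hm).1
    · intro i m hm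
      exact Nat.zero_le _
    · intro i m hm
      have := (hlow i m hm).2
      have := i.2
      simp only [if_pos hm]
      omega
    · intro i m m' hmm hm
      simp only [if_pos hm, if_pos (hmm.trans_lt hm)]
      rcases hmm.eq_or_lt with rfl | h
      · exact le_rfl
      · exact Nat.add_le_add_right (π.row_weak h (hmem i m' hm)) _
    · intro i j m hij hm
      have hij' : (i : ℕ) < j := hij
      have hm' := hm.trans_le (hr hij.le)
      have := j.2
      simp only [if_pos hm, if_pos hm']
      have := π.col_weak (show l - 1 - (j : ℕ) < l - 1 - i by omega) (hmem i m hm)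
      omega
  · obtain ⟨P, hP⟩ := P
    intro i m m' hmm hm
    rw [mem_shape] at hm
    rw [dif_pos hm, dif_pos ⟨hm.1, hmm.trans hm.2⟩]
    refine Nat.sub_le_sub_right (hP.row _ _ _ hmm.le ?_) _
    rw [show l - 1 - i + 1 = l - i by omega]
    exact hm.2
  · obtain ⟨P, hP⟩ := P
    intro i i' m hii hm
    rw [mem_shape] at hm
    have h1 : m < rowLength k t a (l - i) := hm.2.trans_le
      (rowLength_mono ha hpos ⟨by omega, by omega⟩ ⟨by omega, by omega⟩ (by omega))
    rw [dif_pos hm, dif_pos ⟨by omega, h1⟩]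
    dsimp only
    have h2 := hP.add_sub_le hr (show l - 1 - i' ≤ l - 1 - i by omega) (by omega) m
      (by simpa only [show l - 1 - i' + 1 = l - i' by omega] using hm.2)
    omega
  · obtain ⟨P, hP⟩ := P
    intro i m hm
    rw [mem_shape] at hm
    rw [dif_pos hm]
    have h1 := hP.lower ⟨l - 1 - i, by omega⟩ m (by
      simpa only [show l - 1 - i + 1 = l - i by omega] using hm.2)
    dsimp only at h1 ⊢
    -- With `j ≤ a j`, undoing the shift leaves a positive part, so the truncated subtraction is
    -- harmless.
    have h2 := hbound (l - 1 - i + 1) ⟨by omega, by omega⟩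
    omega
  · intro i m hm
    rw [mem_shape] at hm
    rw [dif_neg hm]
  · obtain ⟨P, hP⟩ := P
    intro i m hm
    rw [mem_shape] at hm
    dsimp only
    rw [dif_pos hm]
    have hm' : m < rowLength k t a (l - 1 - i + 1) := by
      rw [show l - 1 - i + 1 = l - i by omega]
      exact hm.2
    have h1 := hP.lower ⟨l - 1 - i, by omega⟩ m hm'
    have h2 := hP.add_le hr ⟨l - 1 - i, by omega⟩ m hm'
    have h3 := hbound (l - i) ⟨by omega, by omega⟩
    simp only [show l - 1 - i + 1 = l - i by omega] at h1 h2
    omega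
  · rintro ⟨π, hπ⟩
    refine Subtype.ext (PlanePartition.ext ?_)
    funext i m
    simp only
    by_cases h : i < l ∧ m < rowLength k t a (l - i)
    · rw [dif_pos h, show l - 1 - i + 1 = l - i by omega, if_pos h.2,
        show l - 1 - (l - 1 - i) = i by omega]
      omega
    · rw [dif_neg h, π.zeros (by rwa [mem_shape])]
  · rintro ⟨P, hP⟩
    refine Subtype.ext ?_
    funext i m
    have hi := i.2
    simp only
    by_cases h : m < rowLength k t a (i + 1)
    · have h1 := hP.lower i m h
      have h2 := hbound (i + 1) ⟨by omega, hi⟩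
      have e : (⟨l - 1 - (l - 1 - (i : ℕ)), by omega⟩ : Fin l) = i := Fin.ext (by simp; omega)
      rw [if_pos h, dif_pos ⟨by omega, by rwa [show l - (l - 1 - (i : ℕ)) = i + 1 by omega]⟩, e]
      omega
    · rw [if_neg h, hP.zeros i m (not_lt.1 h)]

end HalvedHexagon

/-! ### Determinants of products of linear factors. -/

namespace HalvedHexagon

open Finset Polynomial

theorem det_eq_of_forall_col_eq_smul_add_succ {R : Type*} [CommRing R] {n : ℕ}
    {A B : Matrix (Fin (n + 1)) (Fin (n + 1)) R} (c : Fin n → R)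
    (hlast : ∀ i, A i (Fin.last n) = B i (Fin.last n))
    (hcol : ∀ i (j : Fin n), A i j.castSucc = B i j.castSucc + c j * A i j.succ) :
    A.det = B.det := by
  rw [← Matrix.det_submatrix_equiv_self Fin.revPerm A,
    ← Matrix.det_submatrix_equiv_self Fin.revPerm B]
  refine Matrix.det_eq_of_forall_col_eq_smul_add_pred (fun j => c j.rev) (fun i => ?_)
    (fun i j => ?_)
  · simpa using hlast i.rev
  · simpa [Fin.rev_succ, Fin.rev_castSucc] using hcol i.rev j.rev

theorem det_of_last_row_eq_zero {R : Type*} [CommRing R] {n : ℕ}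
    {A : Matrix (Fin (n + 1)) (Fin (n + 1)) R} (h : ∀ j : Fin n, A (Fin.last n) j.castSucc = 0) :
    A.det = A (Fin.last n) (Fin.last n) * (A.submatrix Fin.castSucc Fin.castSucc).det := by
  rw [Matrix.det_succ_row A (Fin.last n), Fin.sum_univ_castSucc, sum_eq_zero]
  · have : (Fin.last n).succAbove = Fin.castSucc := by
      funext i
      simp
    rw [this, ← two_mul, pow_mul]
    simp
  · intro j _
    simp [h]

section MixedProduct

variable {K : Type*} [Field K]

/-- The product of the factors `p X + u s` for `j ≤ s < N` and `q X + w s` for `s < j`. -/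
noncomputable def mixedProd (p q : K) (N : ℕ) (u w : ℕ → K) (j : ℕ) : K[X] :=
  (∏ s ∈ Ico j N, (C p * X + C (u s))) * ∏ s ∈ range j, (C q * X + C (w s))

theorem natDegree_mixedProd_le (p q : K) {N : ℕ} (u w : ℕ → K) {j : ℕ} (hj : j ≤ N) :
    (mixedProd p q N u w j).natDegree ≤ N := by
  refine natDegree_mul_le.trans ?_
  have h1 : (∏ s ∈ Ico j N, (C p * X + C (u s))).natDegree ≤ N - j := by
    refine (natDegree_prod_le _ _).trans ?_
    refine (sum_le_card_nsmul _ _ 1 fun s _ => natDegree_linear_le).trans ?_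
    simp
  have h2 : (∏ s ∈ range j, (C q * X + C (w s))).natDegree ≤ j := by
    refine (natDegree_prod_le _ _).trans ?_
    refine (sum_le_card_nsmul _ _ 1 fun s _ => natDegree_linear_le).trans ?_
    simp
  omega

theorem coeff_prod_linear (q : K) (w : ℕ → K) (n : ℕ) :
    (∏ s ∈ range n, (C q * X + C (w s))).coeff n = q ^ n := by
  have := coeff_prod_of_natDegree_le (s := range n) (f := fun s => C q * X + C (w s)) 1
    (fun s _ => natDegree_linear_le)
  simpa [coeff_C] using this

theorem mixedProd_eq_add {p q : K} (hq : q ≠ 0) {N : ℕ} (u w : ℕ → K) {j : ℕ} (hj : j ≤ N) :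
    mixedProd p q (N + 1) u w j =
      C (u j - p / q * w j) * mixedProd p q N (fun s => u (s + 1)) w j +
        C (p / q) * mixedProd p q (N + 1) u w (j + 1) := by
  unfold mixedProd
  rw [prod_eq_prod_Ico_succ_bot (by omega), prod_range_succ,
    prod_Ico_add' (fun s => C p * X + C (u s)) j N 1]
  have h : C p * X + C (u j) = C (u j - p / q * w j) + C (p / q) * (C q * X + C (w j)) := by
    have : C p = C (p / q) * C q := by rw [← C_mul, div_mul_cancel₀ _ hq]
    rw [this, C_sub, C_mul]
    ring
  rw [h]
  ring

/-- Subtracting `p / q` times the next column cancels the leading terms: column `j` becomes a scalar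
times a product with one factor fewer and `u` shifted. The last row is then zero except in the
corner, and induction applies. -/
theorem det_coeff_mixedProd {p q : K} (hq : q ≠ 0) (N : ℕ) (u w : ℕ → K) :
    (Matrix.of fun s j : Fin (N + 1) => (mixedProd p q N u w j).coeff s).det =
      ∏ m ∈ range N, ∏ j ∈ range (N - m), (q * u (j + m) - p * w j) := by
  induction N generalizing u with
  | zero => simp [mixedProd]
  | succ N ih =>
    let B : Matrix (Fin (N + 2)) (Fin (N + 2)) K := Matrix.of fun s =>
      Fin.snoc (α := fun _ => K) (fun j : Fin (N + 1) => (u j - p / q * w j) *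
        (mixedProd p q N (fun s => u (s + 1)) w j).coeff s)
        ((mixedProd p q (N + 1) u w (N + 1)).coeff s)
    have hB : (Matrix.of fun s j : Fin (N + 2) => (mixedProd p q (N + 1) u w j).coeff s).det =
        B.det := by
      refine det_eq_of_forall_col_eq_smul_add_succ (fun _ => p / q) (fun i => ?_) fun i j => ?_
      · simp [B]
      · simp only [B, Matrix.of_apply, Fin.snoc_castSucc, Fin.val_castSucc, Fin.val_succ]
        rw [mixedProd_eq_add hq u w (by omega), coeff_add, coeff_C_mul, coeff_C_mul]
    have hlast : ∀ j : Fin (N + 1), B (Fin.last _) j.castSucc = 0 := by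
      intro j
      simp only [B, Matrix.of_apply, Fin.snoc_castSucc, Fin.val_last]
      rw [coeff_eq_zero_of_natDegree_lt, mul_zero]
      exact Nat.lt_succ_of_le (natDegree_mixedProd_le _ _ _ _ (by omega))
    rw [hB, det_of_last_row_eq_zero hlast]
    have h1 : B (Fin.last _) (Fin.last _) = q ^ (N + 1) := by
      simp [B, mixedProd, coeff_prod_linear]
    have h2 : B.submatrix Fin.castSucc Fin.castSucc = Matrix.of fun s j : Fin (N + 1) =>
        (u j - p / q * w j) * (Matrix.of fun s j : Fin (N + 1) =>
          (mixedProd p q N (fun s => u (s + 1)) w j).coeff s) s j := by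
      ext s j
      simp [B]
    rw [h1, h2, Matrix.det_mul_row (fun j : Fin (N + 1) => u j - p / q * w j), ih,
      prod_range_succ', mul_comm (∏ m ∈ range N, _), ← mul_assoc]
    congr 1
    · rw [Fin.prod_univ_eq_prod_range (fun j => u j - p / q * w j) (N + 1), Nat.sub_zero]
      -- The corner entry `q ^ (N + 1)` supplies one `q` to each of the `N + 1` column scalars.
      conv_lhs => rw [← card_range (N + 1), ← prod_const, card_range, ← prod_mul_distrib]
      refine prod_congr rfl fun j _ => ?_
      field_simp
      simp
    · refine prod_congr rfl fun m _ => ?_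
      rw [show N + 1 - (m + 1) = N - m by omega]
      exact prod_congr rfl fun j _ => by rw [add_assoc]

theorem det_eval_mixedProd {p q : K} (hq : q ≠ 0) (N : ℕ) (u w : ℕ → K) (x : Fin (N + 1) → K) :
    (Matrix.of fun i j : Fin (N + 1) => (mixedProd p q N u w j).eval (x i)).det =
      (Matrix.vandermonde x).det *
        ∏ m ∈ range N, ∏ j ∈ range (N - m), (q * u (j + m) - p * w j) := by
  rw [← det_coeff_mixedProd hq, ← Matrix.det_mul]
  congr 1
  ext i j
  rw [Matrix.of_apply, Matrix.mul_apply, eval_eq_sum_range' (n := N + 1)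
    (Nat.lt_succ_of_le (natDegree_mixedProd_le _ _ _ _ (by omega))), ← Fin.sum_univ_eq_sum_range
    (fun s => (mixedProd p q N u w j).coeff s * x i ^ s)]
  exact sum_congr rfl fun s _ => by simp [Matrix.vandermonde_apply, mul_comm]

end MixedProduct

/-! ### Factorial forms of matrix entries and Pochhammer symbols. -/

theorem prod_range_sub_eq_descFactorial (n j : ℕ) :
    ∏ s ∈ range j, ((n : ℚ) - s) = n.descFactorial j := by
  induction j with
  | zero => simp
  | succ j ih =>
    rw [prod_range_succ, ih, Nat.descFactorial_succ]
    rcases le_or_gt j n with h | h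
    · rw [Nat.cast_mul, Nat.cast_sub h]
      ring
    · simp [Nat.descFactorial_of_lt h]

theorem factorial_mul_prod_Ico_sub {T N j : ℕ} (hN : N ≤ T) (hj : j ≤ N) :
    ((T - N).factorial : ℚ) * ∏ s ∈ Ico j N, ((T : ℚ) - s) = (T - j).factorial := by
  have h1 := prod_range_mul_prod_Ico (fun s : ℕ => (T : ℚ) - s) hj
  rw [prod_range_sub_eq_descFactorial, prod_range_sub_eq_descFactorial] at h1
  have h2 : ((T - N).factorial : ℚ) * T.descFactorial N = T.factorial := by
    exact_mod_cast Nat.factorial_mul_descFactorial hN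
  have h3 : ((T - j).factorial : ℚ) * T.descFactorial j = T.factorial := by
    exact_mod_cast Nat.factorial_mul_descFactorial (hj.trans hN)
  have h4 : (T.descFactorial j : ℚ) ≠ 0 := by
    exact_mod_cast (Nat.descFactorial_pos.2 (hj.trans hN)).ne'
  apply mul_right_cancel₀ h4
  rw [h3, ← h2, ← h1]
  ring

/-- The auxiliary `N` makes the prefactor independent of `j` and gives every column exactly `N`
linear factors. For `L < j` the factor `s = L` vanishes, in agreement with the default value of
`pathCount`. -/
theorem pathCount_eq {d L N j : ℕ} (hN : N ≤ d + L) (hj : j ≤ N) :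
    pathCount (d + 1) L j = (d + L - N).factorial / (L.factorial * d.factorial) *
      ((∏ s ∈ Ico j N, ((d + L : ℕ) - (s : ℚ))) * ∏ s ∈ range j, ((L : ℚ) - s)) := by
  rw [prod_range_sub_eq_descFactorial]
  have hd : (d.factorial : ℚ) ≠ 0 := by exact_mod_cast d.factorial_ne_zero
  have hL : (L.factorial : ℚ) ≠ 0 := by exact_mod_cast L.factorial_ne_zero
  rcases le_or_gt j L with h | h
  · have h1 := factorial_mul_prod_Ico_sub hN hj
    have h2 : ((L - j).factorial : ℚ) * L.descFactorial j = L.factorial := by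
      exact_mod_cast Nat.factorial_mul_descFactorial h
    have h3 : ((d + L - j).choose (L - j) : ℚ) * d.factorial * (L - j).factorial =
        (d + L - j).factorial := by
      have := Nat.choose_mul_factorial_mul_factorial (show L - j ≤ d + L - j by omega)
      rw [show d + L - j - (L - j) = d by omega] at this
      rw [← this]
      push_cast
      ring
    have h4 : ((L - j).factorial : ℚ) ≠ 0 := by exact_mod_cast (L - j).factorial_ne_zero
    rw [pathCount, if_pos h, Nat.multichoose_eq, show d + 1 + (L - j) - 1 = d + L - j by omega]
    have h5 : (L.descFactorial j : ℚ) = L.factorial / (L - j).factorial := by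
      rw [eq_div_iff h4, ← h2]; ring
    rw [h5]
    have h6 : ((d + L - j).choose (L - j) : ℚ) =
        (d + L - j).factorial / (d.factorial * (L - j).factorial) := by
      rw [eq_div_iff (mul_ne_zero hd h4), ← h3]; ring
    rw [h6, ← h1]
    field_simp
  · rw [pathCount, if_neg (by omega), Nat.descFactorial_of_lt h]
    simp

theorem poch_natCast (y : ℤ) (n : ℕ) : poch y n = ∏ i ∈ range n, ((y : ℚ) + i) := rfl

/-- The convention for negative lengths is what makes the factorial quotient valid also when `B <
A`. -/
theorem poch_add_one_sub (A B : ℕ) :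
    poch ((A : ℤ) + 1) ((B : ℤ) - A) = (B.factorial : ℚ) / A.factorial := by
  have hA : (A.factorial : ℚ) ≠ 0 := by exact_mod_cast A.factorial_ne_zero
  rcases le_or_gt A B with h | h
  · obtain ⟨n, rfl⟩ := Nat.exists_eq_add_of_le h
    rw [show ((A + n : ℕ) : ℤ) - A = (n : ℕ) by push_cast; ring, poch_natCast, eq_div_iff hA]
    clear h
    induction n with
    | zero => simp
    | succ n ih =>
      rw [prod_range_succ, mul_right_comm, ih, ← add_assoc, Nat.factorial_succ]
      push_cast
      ring
  · obtain ⟨n, rfl⟩ := Nat.exists_eq_add_of_lt h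
    have hB : (B.factorial : ℚ) ≠ 0 := by exact_mod_cast B.factorial_ne_zero
    rw [show (B : ℤ) - ((B + n + 1 : ℕ) : ℤ) = Int.negSucc n by
      rw [Int.negSucc_eq]; push_cast; ring]
    have h1 : ∏ i ∈ range (n + 1), ((B + n + 1 : ℕ) - (i : ℚ)) =
        (B + n + 1).factorial / B.factorial := by
      rw [prod_range_sub_eq_descFactorial, eq_div_iff hB]
      have := Nat.factorial_mul_descFactorial (show n + 1 ≤ B + n + 1 by omega)
      rw [show B + n + 1 - (n + 1) = B by omega] at this
      rw [← this]
      push_cast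
      ring
    rw [← inv_div, ← h1]
    simp only [poch]
    congr 1
    refine prod_congr rfl fun i _ => ?_
    push_cast
    ring

end HalvedHexagon

/-! ### The Pochhammer products in `Phi`. -/

namespace HalvedHexagon

open Finset

theorem poch_add (y : ℤ) {m n : ℤ} (hm : 0 ≤ m) (hn : 0 ≤ n) :
    poch y (m + n) = poch y m * poch (y + m) n := by
  lift m to ℕ using hm
  lift n to ℕ using hn
  rw [← Nat.cast_add, poch_natCast, poch_natCast, poch_natCast, prod_range_add]
  congr 1
  refine prod_congr rfl fun i _ => ?_
  push_cast
  ring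

theorem poch_zero (y : ℤ) : poch y 0 = 1 := by
  simpa using poch_natCast y 0

theorem poch_pos {y : ℤ} (hy : 0 < y) {n : ℤ} (hn : 0 ≤ n) : 0 < poch y n := by
  lift n to ℕ using hn
  rw [poch_natCast]
  refine prod_pos fun i _ => ?_
  have : (0 : ℚ) < y := by exact_mod_cast hy
  positivity

theorem prod_Icc_poch_consecutive (z : ℤ) (k q : ℕ) :
    ∏ i ∈ Icc 1 q, poch (z - (k + 1) * i) (k + 1) =
      poch (z - (k + 1) * q) ((k + 1) * q) := by
  induction q with
  | zero => simp [poch_zero]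
  | succ q ih =>
    rw [prod_Icc_succ_top (by omega), ih,
      show ((k : ℤ) + 1) * ((q + 1 : ℕ) : ℤ) = (k + 1) + (k + 1) * q by push_cast; ring,
      poch_add _ (m := k + 1) (n := (k + 1) * q) (by positivity) (by positivity), mul_comm]
    congr 2
    ring

/-- The factor of `Phi` given by a double product, with `y = (k + 1) c + t`. -/
def residueProd (k l : ℕ) (y : ℤ) : ℚ :=
  ∏ j ∈ Icc 1 (k - 1), ∏ i ∈ Icc 1 ((l + k - j) / (k + 1)),
    poch (y + k * (k + 1) * i + (j - 1) * k - (k + 1) * (k - 1)) j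

/-- The last factor of `Phi`, with `y = (k + 1) c + t`. -/
def intervalProd (k l : ℕ) (y : ℤ) : ℚ :=
  ∏ i ∈ Icc 1 (l / (k + 1)),
    poch (y + k * (k + 1) * i - k + 1) ((k + 1) * l + k - (k + 1) ^ 2 * i)

/-- Raising the length by one changes the number of factors only for `j = s`. The cases `s = 0` and
`s = k` lie outside the range of `j`; the first is covered by the empty symbol, the second by the
conditional. -/
theorem residueProd_succ (k q s : ℕ) (hs : s ≤ k) (y : ℤ) :
    residueProd k ((k + 1) * q + s + 1) y = residueProd k ((k + 1) * q + s) y *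
      if s < k then poch (y + k * ((k + 1) * q + s) + 1) s else 1 := by
  have hdiv : ∀ d, (∀ j ∈ Icc 1 (k - 1), ((k + 1) * q + s + d + k - j) / (k + 1) =
      q + (s + d + k - j) / (k + 1)) := fun d j hj => by
    have := mem_Icc.1 hj
    rw [show (k + 1) * q + s + d + k - j = (s + d + k - j) + (k + 1) * q by omega,
      Nat.add_mul_div_left _ _ (by omega), add_comm]
  have hsmall : ∀ e, e < k + 1 → e / (k + 1) = 0 := fun e he => Nat.div_eq_of_lt he
  have hbig : ∀ e, k + 1 ≤ e → e < 2 * (k + 1) → e / (k + 1) = 1 := fun e h1 h2 =>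
    Nat.div_eq_of_lt_le (by omega) (by omega)
  have hfac : residueProd k ((k + 1) * q + s + 1) y = residueProd k ((k + 1) * q + s) y *
      ∏ j ∈ Icc 1 (k - 1), if j = s then poch (y + k * ((k + 1) * q + s) + 1) s else 1 := by
    unfold residueProd
    rw [← prod_mul_distrib]
    refine prod_congr rfl fun j hj => ?_
    have h0 := hdiv 0 j hj
    have h1 := hdiv 1 j hj
    simp only [add_zero] at h0
    have hj' := mem_Icc.1 hj
    rw [h0, h1]
    rcases lt_trichotomy j s with h | rfl | h
    · rw [hbig _ (by omega) (by omega), hbig _ (by omega) (by omega), if_neg h.ne, mul_one]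
    · rw [hbig _ (by omega) (by omega), hsmall _ (by omega), if_pos rfl, add_zero,
        prod_Icc_succ_top (by omega)]
      congr 2
      push_cast
      ring
    · rw [hsmall _ (by omega), hsmall _ (by omega), if_neg h.ne', mul_one]
  rw [hfac]
  congr 1
  rw [prod_ite_eq']
  by_cases h0 : s = 0
  · subst h0
    simp [poch_zero]
  · by_cases h : s < k
    · rw [if_pos (mem_Icc.2 ⟨by omega, by omega⟩), if_pos h]
    · rw [if_neg (fun h' => by have := mem_Icc.1 h'; omega), if_neg h]

/-- Each of the `q` present symbols is lengthened by `k + 1`, and the added blocks are adjacent, so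
they join into one symbol. If `s = k`, a new symbol with index `q + 1` and length `k` also appears.
-/
theorem intervalProd_succ (k q s : ℕ) (hs : s ≤ k) (y : ℤ) :
    intervalProd k ((k + 1) * q + s + 1) y = intervalProd k ((k + 1) * q + s) y *
      poch (y + (k + 1) * (k * q + s) + 1) ((k + 1) * q) *
      if s < k then 1 else poch (y + k * ((k + 1) * q + s) + 1) s := by
  have hq : ((k + 1) * q + s) / (k + 1) = q := by
    rw [add_comm, Nat.add_mul_div_left _ _ (by omega), Nat.div_eq_of_lt (by omega), zero_add]
  have hext : ∏ i ∈ Icc 1 q, poch (y + k * (k + 1) * i - k + 1)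
        ((k + 1) * ((k + 1) * q + s + 1 : ℕ) + k - (k + 1) ^ 2 * i) =
      intervalProd k ((k + 1) * q + s) y *
        poch (y + (k + 1) * (k * q + s) + 1) ((k + 1) * q) := by
    have hz := prod_Icc_poch_consecutive (y + (k + 1) * ((k + 1) * q + s) + 1) k q
    rw [show y + (k + 1) * ((k + 1) * q + s) + 1 - (k + 1) * (q : ℤ) =
      y + (k + 1) * (k * q + s) + 1 by ring] at hz
    rw [intervalProd, hq, ← hz, ← prod_mul_distrib]
    refine prod_congr rfl fun i hi => ?_
    have hi' : (i : ℤ) ≤ q := by exact_mod_cast (mem_Icc.1 hi).2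
    have hnn : (0 : ℤ) ≤ (k + 1) * ((k + 1) * q + s : ℕ) + k - (k + 1) ^ 2 * i := by
      push_cast
      have : (0 : ℤ) ≤ (k + 1) ^ 2 * (q - i) := mul_nonneg (by positivity) (by omega)
      have : (0 : ℤ) ≤ (k + 1) * s + k := by positivity
      linarith
    rw [show ((k : ℤ) + 1) * ((k + 1) * q + s + 1 : ℕ) + k - (k + 1) ^ 2 * i =
      ((k + 1) * ((k + 1) * q + s : ℕ) + k - (k + 1) ^ 2 * i) + (k + 1) by push_cast; ring,
      poch_add _ hnn (by positivity)]
    congr 2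
    push_cast
    ring
  by_cases h : s < k
  · have hq' : ((k + 1) * q + s + 1) / (k + 1) = q := by
      rw [add_assoc, add_comm, Nat.add_mul_div_left _ _ (by omega),
        Nat.div_eq_of_lt (by omega), zero_add]
    rw [if_pos h, mul_one, ← hext]
    rw [intervalProd, hq']
  · obtain rfl : s = k := by omega
    have hq' : ((s + 1) * q + s + 1) / (s + 1) = q + 1 := by
      rw [show (s + 1) * q + s + 1 = (s + 1) * (q + 1) by ring]
      exact Nat.mul_div_cancel_left _ (by omega)
    rw [if_neg h, ← hext]
    rw [intervalProd, hq', prod_Icc_succ_top (by omega)]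
    congr 2 <;> (push_cast; ring)

/-- Writing `l = (k + 1) q + s`, the new symbol splits into pieces of lengths `s` and `(k + 1) q`,
which are exactly the increments of the two products. -/
theorem prod_poch_eq_residueProd_mul_intervalProd (k l : ℕ) (y : ℤ) :
    ∏ m ∈ range l, poch (y + k * m + 1) m = residueProd k l y * intervalProd k l y := by
  induction l with
  | zero =>
    have h1 : residueProd k 0 y = 1 := by
      refine prod_eq_one fun j hj => ?_
      have := mem_Icc.1 hj
      rw [Nat.div_eq_of_lt (by omega)]
      simp
    rw [h1]
    simp [intervalProd]
  | succ l ih =>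
    rw [prod_range_succ, ih]
    have hl := Nat.div_add_mod l (k + 1)
    have hs := Nat.mod_lt l (Nat.succ_pos k)
    set q := l / (k + 1)
    set s := l % (k + 1)
    clear_value q s
    subst hl
    rw [residueProd_succ k q s (by omega), intervalProd_succ k q s (by omega)]
    have hp : poch (y + k * ((k + 1) * q + s : ℕ) + 1) ((k + 1) * q + s : ℕ) =
        poch (y + k * ((k + 1) * q + s) + 1) s *
          poch (y + (k + 1) * (k * q + s) + 1) ((k + 1) * q) := by
      push_cast
      rw [add_comm (((k : ℤ) + 1) * q) s, poch_add _ (by positivity) (by positivity)]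
      congr 2; ring
    rw [hp]
    split_ifs <;> ring

/-- `Phi k l a t x h` is the ratio of the values of this function at `x + h` and at `h`. -/
def psi (k l : ℕ) (a : ℕ → ℕ) (t c : ℤ) : ℚ :=
  (∏ i ∈ Icc 1 l, poch (c + l + 1 - a i) (t + (k + 1) * a i - l - k)) *
    ∏ m ∈ range l, poch ((k + 1) * c + t + k * m + 1) m

theorem Phi_eq_psi_div_psi (k l : ℕ) (a : ℕ → ℕ) (t x h : ℤ) :
    Phi k l a t x h = psi k l a t (x + h) / psi k l a t h := by
  simp only [psi, prod_poch_eq_residueProd_mul_intervalProd, Phi, residueProd, intervalProd,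
    prod_div_distrib]
  rw [div_mul_div_comm, div_mul_div_comm, mul_assoc, mul_assoc]

end HalvedHexagon

/-! ### Evaluation of the determinant and telescoping. -/

namespace HalvedHexagon

open Finset

/-- The determinant that counts the fillings with entries below `n`. -/
def countDet (k t l : ℕ) (a : ℕ → ℕ) (n : ℕ) : ℚ :=
  (Matrix.of fun i j : Fin l =>
    pathCount (n - a (i + 1)) (rowLength k t a (i + 1) + i) j).det

theorem poch_eq_factorial_div {k l t c b : ℕ} (hb : 1 ≤ b) (hbc : b ≤ c + l) :
    poch ((c : ℤ) + l + 1 - b) (t + (k + 1) * b - l - k) =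
      ((c + t + k * (b - 1)).factorial : ℚ) / (c + l - b).factorial := by
  rw [← poch_add_one_sub]
  push_cast [hb, hbc]
  congr 1 <;> ring

theorem psi_ne_zero {k l t c : ℕ} {a : ℕ → ℕ} (hpos : ∀ i ∈ Set.Icc 1 l, 1 ≤ a i)
    (hle : ∀ i ∈ Set.Icc 1 l, a i ≤ c + l) : psi k l a t c ≠ 0 := by
  refine mul_ne_zero (prod_ne_zero_iff.2 fun i hi => ?_) (prod_ne_zero_iff.2 fun m _ => ?_)
  · rw [poch_eq_factorial_div (hpos i (by simpa using hi)) (hle i (by simpa using hi))]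
    exact div_ne_zero (by exact_mod_cast Nat.factorial_ne_zero _)
      (by exact_mod_cast Nat.factorial_ne_zero _)
  · exact (poch_pos (by positivity) (by positivity)).ne'

theorem prod_cross_eq (k t c N : ℕ) :
    ∏ m ∈ range N, ∏ j ∈ range (N - m), (((k : ℚ) + 1) *
        ((c + (N + 1) + t - k - 1) - (j + m : ℕ)) - k * ((t - k - 1) - (j : ℕ))) =
      ∏ m ∈ range (N + 1), poch (((k : ℤ) + 1) * c + t + k * m + 1) m := by
  rw [prod_range_succ', Nat.cast_zero, poch_zero, mul_one, ← prod_range_reflect]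
  refine prod_congr rfl fun m hm => ?_
  have hm' := mem_range.1 hm
  rw [show N - (N - 1 - m) = m + 1 by omega, poch_natCast, ← prod_range_reflect]
  refine prod_congr rfl fun j hj => ?_
  have hj' := mem_range.1 hj
  have h1 : ((m + 1 - 1 - j + (N - 1 - m) : ℕ) : ℚ) = N - 1 - j := by
    rw [show m + 1 - 1 - j + (N - 1 - m) = N - (1 + j) by omega, Nat.cast_sub (by omega)]
    push_cast
    ring
  have h2 : ((m + 1 - 1 - j : ℕ) : ℚ) = m - j := by
    rw [show m + 1 - 1 - j = m - j by omega, Nat.cast_sub (by omega)]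
  rw [h1, h2]
  push_cast
  ring

/-- The constant `κ` collects what does not involve `c`: the Vandermonde determinant in the `a i`
and the factorials of the second argument of `pathCount`. -/
theorem countDet_eq_mul_psi (k t N : ℕ) {a : ℕ → ℕ} (ha : StrictMonoOn a (Set.Icc 1 (N + 1)))
    (hpos : ∀ i ∈ Set.Icc 1 (N + 1), 1 ≤ a i) :
    ∃ κ : ℚ, ∀ c : ℕ, (∀ i ∈ Set.Icc 1 (N + 1), a i ≤ c + (N + 1)) →
      countDet k t (N + 1) a (c + (N + 1) + 1) = κ * psi k (N + 1) a t c := by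
  refine ⟨(∏ i : Fin (N + 1), (((rowLength k t a (i + 1) + i).factorial : ℚ))⁻¹) *
    (Matrix.vandermonde fun i : Fin (N + 1) => (a (i + 1) : ℚ)).det, fun c hc => ?_⟩
  have hq : ((k : ℚ) + 1) ≠ 0 := by positivity
  -- In the notation of `pathCount_eq`, `d + L` and `L` are affine in `a (i + 1)` with slopes `k`
  -- and `k + 1`; `u` and `w` are their constant terms minus `s`. Only `u` involves `c`.
  have hdet := det_eval_mixedProd (p := (k : ℚ)) hq N
    (fun s => (c + (N + 1) + t - k - 1) - s) (fun s => (t - k - 1) - s)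
    (fun i : Fin (N + 1) => (a (i + 1) : ℚ))
  rw [prod_cross_eq] at hdet
  have hentry : (Matrix.of fun i j : Fin (N + 1) =>
      pathCount (c + (N + 1) + 1 - a (i + 1)) (rowLength k t a (i + 1) + i) j) =
      Matrix.of fun i j : Fin (N + 1) =>
        ((((rowLength k t a (i + 1) + i).factorial : ℚ))⁻¹ *
          poch ((c : ℤ) + (N + 1 : ℕ) + 1 - a (i + 1))
            (t + (k + 1) * a (i + 1) - (N + 1 : ℕ) - k)) *
        (Matrix.of fun i j : Fin (N + 1) => (mixedProd (k : ℚ) (k + 1) N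
          (fun s => (c + (N + 1) + t - k - 1) - s) (fun s => (t - k - 1) - s) j).eval
            (a (i + 1) : ℚ)) i j := by
    ext i j
    have hi : (i : ℕ) + 1 ∈ Set.Icc 1 (N + 1) := ⟨by omega, i.2⟩
    have h1 := hpos _ hi
    have h2 := hc _ hi
    have h3 := rowLength_cast (k := k) (t := t) ha hpos _ hi
    have hL : ((rowLength k t a (i + 1) + i : ℕ) : ℤ) = t + (k + 1) * a (i + 1) - k - 1 := by
      push_cast at h3 ⊢
      rw [h3]
      ring
    have hLq : ((rowLength k t a (i + 1) + i : ℕ) : ℚ) = t + (k + 1) * a (i + 1) - k - 1 := by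
      exact_mod_cast hL
    have hT : c + (N + 1) - a (i + 1) + (rowLength k t a (i + 1) + i) =
        c + t + k * (a (i + 1) - 1) + N := by
      zify [h1, h2]
      push_cast at hL
      rw [hL]
      ring
    rw [Matrix.of_apply, Matrix.of_apply, Matrix.of_apply,
      show c + (N + 1) + 1 - a (i + 1) = c + (N + 1) - a (i + 1) + 1 by omega,
      pathCount_eq (N := N) (by omega) (by omega), poch_eq_factorial_div h1 h2, hT, hLq,
      Nat.add_sub_cancel]
    congr 1
    · ring
    simp only [mixedProd, Polynomial.eval_mul, Polynomial.eval_prod, Polynomial.eval_add,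
      Polynomial.eval_C, Polynomial.eval_X]
    congr 1
    · refine prod_congr rfl fun s _ => ?_
      push_cast [h1]
      ring
    · refine prod_congr rfl fun s _ => ?_
      ring
  rw [countDet, hentry, Matrix.det_mul_column, hdet, prod_mul_distrib, psi,
    Fin.prod_univ_eq_prod_range (fun i => poch ((c : ℤ) + (N + 1 : ℕ) + 1 - a (i + 1))
      (t + (k + 1) * a (i + 1) - (N + 1 : ℕ) - k)) (N + 1), range_eq_Ico,
    prod_Ico_add' (fun i => poch ((c : ℤ) + (N + 1 : ℕ) + 1 - a i)
      (t + (k + 1) * a i - (N + 1 : ℕ) - k)) 0 (N + 1) 1]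
  have : Ico (0 + 1) (N + 1 + 1) = Icc 1 (N + 1) := by
    ext
    simp
  rw [this]
  ring

theorem countDet_eq_Phi_mul (k t l : ℕ) {a : ℕ → ℕ} (ha : StrictMonoOn a (Set.Icc 1 l))
    (hpos : ∀ i ∈ Set.Icc 1 l, 1 ≤ a i) {c x : ℕ}
    (hc : ∀ i ∈ Set.Icc 1 l, a i ≤ c + l) :
    countDet k t l a (x + c + l + 1) = Phi k l a t x c * countDet k t l a (c + l + 1) := by
  rw [Phi_eq_psi_div_psi]
  cases l with
  | zero => simp [countDet, psi]
  | succ N =>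
    obtain ⟨κ, hκ⟩ := countDet_eq_mul_psi k t N ha hpos
    have h0 : psi k (N + 1) a t c ≠ 0 := psi_ne_zero hpos hc
    rw [hκ c hc, hκ (x + c) fun i hi => by have := hc i hi; omega]
    push_cast
    field_simp

/-- In the last row only the value `a (l + 1)` is allowed. Algebraically, subtracting from each
column its successor removes one letter, which clears the last row up to a final `1`. -/
theorem countDet_succ (k t l : ℕ) {a : ℕ → ℕ} (ha : StrictMonoOn a (Set.Icc 1 (l + 1))) :
    countDet k t (l + 1) a (a (l + 1) + 1) = countDet k t l a (a (l + 1)) := by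
  let B : Matrix (Fin (l + 1)) (Fin (l + 1)) ℚ := Matrix.of fun i =>
    Fin.snoc (α := fun _ => ℚ) (fun j : Fin l =>
      pathCount (a (l + 1) - a (i + 1)) (rowLength k t a (i + 1) + i) j)
      (pathCount (a (l + 1) + 1 - a (i + 1)) (rowLength k t a (i + 1) + i) l)
  have hB : countDet k t (l + 1) a (a (l + 1) + 1) = B.det := by
    refine det_eq_of_forall_col_eq_smul_add_succ (fun _ => 1) (fun i => ?_) fun i j => ?_
    · simp [B]
    · have hi : a (i + 1) ≤ a (l + 1) := ha.monotoneOn ⟨by omega, i.2⟩ ⟨by omega, le_rfl⟩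
        (by have := i.2; omega)
      simp only [B, Matrix.of_apply, Fin.snoc_castSucc, Fin.val_castSucc, Fin.val_succ, one_mul]
      rw [show a (l + 1) + 1 - a (i + 1) = a (l + 1) - a (i + 1) + 1 by omega,
        pathCount_succ_column]
  have hlast : ∀ j : Fin l, B (Fin.last l) j.castSucc = 0 := by
    intro j
    have := j.2
    simp only [B, Matrix.of_apply, Fin.snoc_castSucc, Fin.val_last, Nat.sub_self]
    rw [pathCount, if_pos (by omega), show rowLength k t a (l + 1) + l - j =
      rowLength k t a (l + 1) + (l - j - 1) + 1 by omega, Nat.multichoose_zero_succ,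
      Nat.cast_zero]
  rw [hB, det_of_last_row_eq_zero hlast, countDet]
  have h1 : B (Fin.last l) (Fin.last l) = 1 := by
    simp [B, pathCount]
  rw [h1, one_mul]
  congr 1
  ext i j
  simp [B]

theorem countDet_eq_prod (k t l : ℕ) {a : ℕ → ℕ} (ha : StrictMonoOn a (Set.Icc 1 (l + 1)))
    (hpos : ∀ i ∈ Set.Icc 1 (l + 1), 1 ≤ a i) :
    countDet k t l a (a (l + 1)) =
      ∏ i ∈ Icc 1 l, Phi k i a t ((a (i + 1) : ℤ) - a i - 1) ((a i : ℤ) - i) := by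
  induction l with
  | zero => simp [countDet]
  | succ l ih =>
    have hsub : Set.Icc 1 (l + 1) ⊆ Set.Icc 1 (l + 1 + 1) := Set.Icc_subset_Icc le_rfl (by omega)
    have ha' := ha.mono hsub
    have hpos' := fun i hi => hpos i (hsub hi)
    have h1 : l + 1 ≤ a (l + 1) := le_of_strictMonoOn ha' hpos' _ ⟨by omega, le_rfl⟩
    have h2 : a (l + 1) < a (l + 1 + 1) :=
      ha ⟨by omega, by omega⟩ ⟨by omega, le_rfl⟩ (by omega)
    rw [prod_Icc_succ_top (by omega), ← ih ha' hpos', ← countDet_succ k t l ha', mul_comm]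
    -- These `c` and `x` move the bound from `a (l + 1) + 1`, where the last row is frozen, up to `a
    -- (l + 1 + 1)`.
    have key := countDet_eq_Phi_mul k t (l + 1) ha' hpos' (c := a (l + 1) - (l + 1))
      (x := a (l + 1 + 1) - a (l + 1) - 1) (fun i hi => by
        have := ha'.monotoneOn hi ⟨by omega, le_rfl⟩ hi.2
        omega)
    rw [show a (l + 1 + 1) - a (l + 1) - 1 + (a (l + 1) - (l + 1)) + (l + 1) + 1 =
        a (l + 1 + 1) by omega,
      show a (l + 1) - (l + 1) + (l + 1) + 1 = a (l + 1) + 1 by omega] at key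
    rw [key]
    congr 2 <;> omega

theorem card_fillings_eq_countDet (k t l n : ℕ) {a : ℕ → ℕ}
    (ha : StrictMonoOn a (Set.Icc 1 l)) (hpos : ∀ i ∈ Set.Icc 1 l, 1 ≤ a i)
    (hle : ∀ i ∈ Set.Icc 1 l, a i ≤ n) :
    ((fillings n (fun i : Fin l => a (i + 1)) 0
      (fun i : Fin l => rowLength k t a (i + 1))).card : ℚ) = countDet k t l a n := by
  cases l with
  | zero =>
    have : fillings n (fun i : Fin 0 => a (i + 1)) 0 (fun i => rowLength k t a (i + 1)) =
        univ := by
      ext P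
      rw [mem_fillings]
      exact ⟨fun _ => mem_univ _, fun _ => by constructor <;> exact fun i => i.elim0⟩
    simp [this, countDet]
  | succ N =>
    have hmem : ∀ i : Fin (N + 1), (i : ℕ) + 1 ∈ Set.Icc 1 (N + 1) := fun i => ⟨by omega, i.2⟩
    rw [card_fillings]
    · simp [countDet]
    · exact fun i j hij => ha.monotoneOn (hmem i) (hmem j) (by simpa using hij)
    · exact fun i => hle _ (hmem i)
    · exact Nat.zero_le _
    · exact fun i j hij => rowLength_mono ha hpos (hmem i) (hmem j) (by simpa using hij)

end HalvedHexagon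

theorem corollary1p2 (k x t h l : ℕ) (a : ℕ → ℕ)
    (ha : StrictMonoOn a (Set.Icc 1 l))
    (ha_pos : ∀ i ∈ Set.Icc 1 l, 1 ≤ a i)
    (ha_le : ∀ i ∈ Set.Icc 1 l, a i ≤ h + l)
    (ha_last : a (l + 1) = l + h + 1) :
    (Nat.card {π : HalvedHexagon.PlanePartition (HalvedHexagon.shape k t l a ha ha_pos) //
        ∀ i j : ℕ, (i, j) ∈ HalvedHexagon.shape k t l a ha ha_pos →
          (a (l - i) : ℤ) - l + (i + 1) ≤ π.entry i j ∧ π.entry i j ≤ x + h + 1} : ℚ) =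
      HalvedHexagon.Phi k l a t x h *
        ∏ i ∈ Finset.Icc 1 l,
          HalvedHexagon.Phi k i a t ((a (i + 1) : ℤ) - a i - 1) ((a i : ℤ) - i) := by
  have ha' : StrictMonoOn a (Set.Icc 1 (l + 1)) := by
    intro i hi j hj hij
    rcases Nat.lt_or_ge l j with hlj | hlj
    · obtain rfl : j = l + 1 := le_antisymm hj.2 hlj
      have := ha_le i ⟨hi.1, by omega⟩
      omega
    · exact ha ⟨hi.1, by omega⟩ ⟨hj.1, hlj⟩ hij
  have hpos' : ∀ i ∈ Set.Icc 1 (l + 1), 1 ≤ a i := fun i hi => by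
    rcases Nat.lt_or_ge l i with hli | hli
    · obtain rfl : i = l + 1 := le_antisymm hi.2 hli
      omega
    · exact ha_pos i ⟨hi.1, hli⟩
  have hcard := HalvedHexagon.card_planePartition k t l (x + h) a ha ha_pos
  have hdet := HalvedHexagon.card_fillings_eq_countDet k t l (x + h + l + 1) ha ha_pos
    (fun i hi => by have := ha_le i hi; omega)
  -- The convention for `a (l + 1)` makes the bound at `x = 0` equal to the start of the telescoping
  -- product.
  rw [HalvedHexagon.countDet_eq_Phi_mul k t l ha ha_pos ha_le, show h + l + 1 = a (l + 1) by omega,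
    HalvedHexagon.countDet_eq_prod k t l ha' hpos', ← hcard] at hdet
  rw [← hdet]
  norm_cast
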